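/- Let $K$ be a field. A $K$-variety is a separated reduced $K$-scheme of finite type and of dimension $>0$ (not necessarily irreducible). Let $X$ be a quasi-projective integral $K$-variety, i.e. an integral $K$-variety admitting a locally closed immersion over $K$ into some $\mathbb{P}^n_K$. A subset $M\subset X(K)$ is called thin if there are a $K$-variety $Y$ (possibly reducible) and a $K$-morphism $f\colon Y\to X$ such that $M\subset f(Y(K))$, the fibre of $f$ over the generic point of $X$ is finite, and $f$ has no rational section (that is, there is no morphism $\psi\colon U\to Y$ on a dense open $U\subset X$ such that $f\circ\psi$ is the inclusion $U\hookrightarrow X$). The variety $X$ has the Hilbert Property if $X(K)$ is not thin. A cover of $X$ is a finite surjective $K$-morphism $\phi\colon Y\to X$ where $Y$ is a normal and geometrically integral $K$-variety; its degree is $[K(Y):K(X)]$, where $K(\cdot)$ denotes the function field. (1) A subset $M\subset X(K)$ is thin if and only if there is a finite (possibly empty) family of covers $\phi_i\colon Y_i\to X$ $(i=1,\dots,r)$ of degree $>1$ such that $M\setminus\bigcup_{i=1}^r\phi_i(Y_i(K))$ is not Zariski dense in $X$. (2) $X$ has the Hilbert Property if and only if for every finite (possibly empty) family of covers $\phi_i\colon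 Y_i\to X$ $(i=1,\dots,r)$ of degree $>1$, the set $X(K)\setminus\bigcup_{i=1}^r\phi_i(Y_i(K))$ is Zariski dense in $X$. -/

import Mathlib

open CategoryTheory AlgebraicGeometry

universe u

namespace HilbertProp

noncomputable section

/-- Projective `n`-space over `K` as a `K`-scheme: `Proj K[x₀, …, xₙ]` with the standard grading. -/
def projectiveSpace (n : ℕ) (K : Type u) [Field K] : Over (Spec (.of K)) :=
  letI := MvPolynomial.gradedAlgebra (σ := Fin (n + 1)) (R := K)
  Over.mk (Proj.toSpecZero (MvPolynomial.homogeneousSubmodule (Fin (n + 1)) K) ≫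
    Spec.map (CommRingCat.ofHom
      (algebraMap K (MvPolynomial.homogeneousSubmodule (Fin (n + 1)) K 0))))

variable {K : Type u} [Field K]

/-- A `K`-variety: a separated reduced `K`-scheme of finite type and of dimension `> 0`
(not necessarily irreducible). -/
structure IsVariety (X : Over (Spec (.of K))) : Prop where
  isSeparated : IsSeparated X.hom
  locallyOfFiniteType : LocallyOfFiniteType X.hom
  quasiCompact : QuasiCompact X.hom
  isReduced : IsReduced X.left
  dim_pos : 0 < topologicalKrullDim X.left

/-- A `K`-scheme is quasi-projective if it admits a (locally closed) immersion over `K`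
into some projective space over `K`. -/
def IsQuasiProjective (X : Over (Spec (.of K))) : Prop :=
  ∃ (n : ℕ) (i : X ⟶ projectiveSpace n K), IsImmersion i.left

/-- A scheme is normal if all its local rings are integrally closed domains. -/
def IsNormal (X : Scheme.{u}) : Prop :=
  ∀ x : X, IsDomain (X.presheaf.stalk x) ∧ IsIntegrallyClosed (X.presheaf.stalk x)

/-- The set `X(K)` of rational points: `K`-morphisms `Spec K ⟶ X`. -/
abbrev RationalPoints (X : Over (Spec (.of K))) : Type u :=
  Over.mk (𝟙 (Spec (.of K))) ⟶ X

/-- The image `f(Y(K)) ⊆ X(K)` of the rational points of `Y` under a `K`-morphism `f`. -/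
def imagePoints {X Y : Over (Spec (.of K))} (f : Y ⟶ X) : Set (RationalPoints X) :=
  Set.range fun y : RationalPoints Y => y ≫ f

/-- A set `M` of rational points of `X` is Zariski dense if the set of points of the scheme `X`
underlying the elements of `M` is dense. -/
def IsZariskiDense {X : Over (Spec (.of K))} (M : Set (RationalPoints X)) : Prop :=
  Dense (⋃ x ∈ M, Set.range x.left : Set X.left)

/-- `f : Y ⟶ X` has a rational section: a morphism `ψ : U ⟶ Y` on a dense open `U` of `X` such that
`ψ ≫ f` is the inclusion of `U`. Such a `ψ` is automatically a `K`-morphism. -/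
def HasRationalSection {X Y : Over (Spec (.of K))} (f : Y ⟶ X) : Prop :=
  ∃ ψ : X.left.PartialMap Y.left, ψ.hom ≫ f.left = ψ.domain.ι

/-- Thin subsets of `X(K)`. Note that `Y` need not be irreducible. -/
def IsThin (X : Over (Spec (.of K))) [IsIntegral X.left] (M : Set (RationalPoints X)) : Prop :=
  ∃ (Y : Over (Spec (.of K))) (f : Y ⟶ X), IsVariety Y ∧ M ⊆ imagePoints f ∧
    (f.left ⁻¹' {genericPoint X.left}).Finite ∧ ¬ HasRationalSection f

/-- `X` has the Hilbert Property if `X(K)` is not thin. -/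
def HasHilbertProperty (X : Over (Spec (.of K))) [IsIntegral X.left] : Prop :=
  ¬ IsThin X Set.univ

/-- A dominant morphism of integral schemes maps the generic point to the generic point. -/
theorem map_genericPoint {X Y : Scheme.{u}} [IsIntegral X] [IsIntegral Y] (f : Y ⟶ X)
    [IsDominant f] : f (genericPoint Y) = genericPoint X := by
  have h := (genericPoint_spec Y).image f.continuous
  rw [Set.image_univ, f.denseRange.closure_range] at h
  exact h.eq (genericPoint_spec X)

/-- The extension of function fields `K(X) ⟶ K(Y)` induced by a dominant morphism `Y ⟶ X`. -/
def functionFieldMap {X Y : Scheme.{u}} [IsIntegral X] [IsIntegral Y] (f : Y ⟶ X)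
    [IsDominant f] : X.functionField ⟶ Y.functionField :=
  X.presheaf.stalkSpecializes (specializes_of_eq (map_genericPoint f)) ≫
    f.stalkMap (genericPoint Y)

/-- The degree `[K(Y) : K(X)]` of a dominant morphism `Y ⟶ X` of integral schemes
(only used for finite morphisms, where it is the degree of a finite field extension). -/
def degree {X Y : Scheme.{u}} [IsIntegral X] [IsIntegral Y] (f : Y ⟶ X) [IsDominant f] : ℕ :=
  letI := (functionFieldMap f).hom.toAlgebra
  Module.finrank X.functionField Y.functionField

/-- A cover of `X`: a finite surjective `K`-morphism `Y ⟶ X` from a normal and geometrically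
integral `K`-variety `Y`. -/
structure Cover (X : Over (Spec (.of K))) where
  Y : Over (Spec (.of K))
  φ : Y ⟶ X
  isVariety : IsVariety Y
  isIntegral : IsIntegral Y.left
  isNormal : IsNormal Y.left
  geometricallyIntegral : GeometricallyIntegral Y.hom
  isFinite : IsFinite φ.left
  surjective : Surjective φ.left

/-- The degree `[K(Y) : K(X)]` of a cover `Y ⟶ X`. -/
def Cover.degree {X : Over (Spec (.of K))} [IsIntegral X.left] (c : Cover X) : ℕ :=
  haveI := c.isIntegral
  haveI := c.surjective
  HilbertProp.degree c.φ.left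

end

end HilbertProp

/-!
Thin sets are described by covers. Both parts follow from the equivalence of `IsThin X M` with
`HilbertProp.IsAlmostCovered X M`, the right-hand side of the first part; the second part is the
first for `M = X(K)`.

*Thin sets are almost covered.* Let `f : Y ⟶ X` witness that `M` is thin, and treat the finitely
many irreducible components of `Y` one by one. The image of a closed subset of `Y` without points
over the generic point of `X` is not dense (`notMem_closure_image_of_forall_ne`), so only a
component whose generic point `y` lies over the generic point of `X` matters. As the generic fibre
of `f` is finite, `𝒪_{Y,y}` is a finite extension `L` of `K(X)`, and `[L : K(X)] > 1` because `f` has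
no rational section. If some open neighbourhood of `y` has no rational points, the rational points of
the component lie on a closed subset without `y`. Otherwise every finitely generated `K`-subalgebra
of `L` has a `K`-algebra homomorphism to `K`, by spreading out from `y`; hence `L ⊗ K'` is a domain
for every extension `K'` of `K` (`noZeroDivisors_tensorProduct_of_forall_nonempty_algHom`), and the
normalization of `X` in `L` is geometrically integral. It is finite over `X`
(`finite_integralClosure_of_finiteType`), so it is a cover of degree `[L : K(X)] > 1`. An open
neighbourhood of `y` maps to it over `X`, so the rational points of this neighbourhood have their
images in the image of the cover, and the other rational points of the component lie on a closed
subset without `y`.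

*Almost covered sets are thin.* Thin sets are closed under finite unions (disjoint unions of the
varieties `Y`). The image of a cover of degree `> 1` is thin, as a rational section of a finite
morphism of integral schemes forces the degree to be `1`. A set that is not dense is contained in
a proper closed subscheme `W ≠ ∅`, and `𝔸¹ × W ⟶ X` shows that it is thin; the factor `𝔸¹` is there
because varieties have positive dimension.
-/

/-! ### Finiteness of integral closures -/

theorem exists_finite_extension_forall_mem_exists_pow_eq (k : Type u) [Field k] {q : ℕ}
    (hq : 0 < q) (T : Set k) (hT : T.Finite) :
    ∃ (k' : Type u) (_ : Field k') (_ : Algebra k k'), FiniteDimensional k k' ∧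
      ∀ a ∈ T, ∃ b : k', b ^ q = algebraMap k k' a := by
  choose r hr using fun a : k =>
    IsAlgClosed.exists_pow_nat_eq (algebraMap k (AlgebraicClosure k) a) hq
  have := hT.to_subtype
  refine ⟨IntermediateField.adjoin k (r '' T), inferInstance, inferInstance,
    IntermediateField.finiteDimensional_adjoin fun x _ =>
      Algebra.IsIntegral.isIntegral x, fun a ha => ?_⟩
  refine ⟨⟨r a, IntermediateField.subset_adjoin _ _ ⟨a, ha, rfl⟩⟩, ?_⟩
  ext
  simpa using hr a

namespace MvPolynomial

variable {σ k k' : Type*} [Field k] [Field k'] [Algebra k k']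

/-- The ring homomorphism `k[xᵢ] → k'[xᵢ]` sending `xᵢ` to `xᵢ ^ q`. -/
noncomputable def mapExpand (σ k k' : Type*) [Field k] [Field k'] [Algebra k k'] (q : ℕ) :
    MvPolynomial σ k →+* MvPolynomial σ k' :=
  (expand q : MvPolynomial σ k' →ₐ[k'] _).toRingHom.comp (map (algebraMap k k'))

theorem mapExpand_monomial (q : ℕ) (d : σ →₀ ℕ) (a : k) :
    mapExpand σ k k' q (monomial d a) = monomial (q • d) (algebraMap k k' a) := by
  simp [mapExpand, expand_monomial]

theorem mapExpand_injective {q : ℕ} (hq : 0 < q) : Function.Injective (mapExpand σ k k' q) :=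
  (expand_injective hq).comp (map_injective (σ := σ) _ (algebraMap k k').injective)

theorem mapExpand_comp_C (q : ℕ) :
    (mapExpand σ k k' q).comp C = C.comp (algebraMap k k') := by
  ext a
  simp [mapExpand]

theorem mapExpand_finite [Finite σ] {q : ℕ} (hq : 0 < q) [FiniteDimensional k k'] :
    (mapExpand σ k k' q).Finite := by
  apply RingHom.IsIntegral.to_finite
  · intro f
    induction f using MvPolynomial.induction_on with
    | C a =>
      have h : (algebraMap k k').IsIntegralElem a := Algebra.IsIntegral.isIntegral a
      obtain ⟨P, hP, h0⟩ := h
      refine ⟨P.map C, hP.map _, ?_⟩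
      rw [Polynomial.eval₂_map, mapExpand_comp_C, ← Polynomial.hom_eval₂, h0, map_zero]
    | add f g hf hg => exact hf.add _ hg
    | mul_X f i hf =>
      refine hf.mul _ ?_
      have h : (X i : MvPolynomial σ k') ^ q = mapExpand σ k k' q (X i) := by simp [mapExpand]
      refine ⟨Polynomial.X ^ q - Polynomial.C (X i), Polynomial.monic_X_pow_sub_C _ hq.ne', ?_⟩
      simp [h]
  · have h : ((mapExpand σ k k' q).comp C).FiniteType := by
      rw [mapExpand_comp_C]
      exact RingHom.FiniteType.comp ((RingHom.finiteType_algebraMap).mpr inferInstance)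
        ((RingHom.finiteType_algebraMap).mpr inferInstance)
    exact RingHom.FiniteType.of_comp_finiteType h

theorem exists_pow_eq_mapExpand (p n : ℕ) [ExpChar k' p] (f : MvPolynomial σ k)
    (hf : ∀ d ∈ f.support, ∃ b : k', b ^ p ^ n = algebraMap k k' (f.coeff d)) :
    ∃ g, g ^ p ^ n = mapExpand σ k k' (p ^ n) f := by
  choose! b hb using hf
  refine ⟨∑ d ∈ f.support, monomial d (b d), ?_⟩
  conv_rhs => rw [f.as_sum]
  rw [map_sum, sum_pow_char_pow]
  refine Finset.sum_congr rfl fun d hd => ?_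
  rw [mapExpand_monomial, monomial_pow, hb d hd]

end MvPolynomial

open Polynomial in
/-- Let `q` be a power of the characteristic exponent. If `y ^ q` is separable over `F` and the
coefficients of its minimal polynomial are `q`-th powers in `F'`, then `y` is separable over `F'`:
the polynomial of the `q`-th roots of the coefficients is separable and vanishes at `y`. -/
theorem Polynomial.Separable.isSeparable_of_pow {F F' Ω : Type*} [Field F] [Field F'] [Field Ω]
    [Algebra F F'] [Algebra F' Ω] [Algebra F Ω] [IsScalarTower F F' Ω] (p n : ℕ) [ExpChar F' p]
    (y : Ω) (hsep : IsSeparable F (y ^ p ^ n))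
    (hcoeff : ∀ i, ∃ c : F', c ^ p ^ n = algebraMap F F' ((minpoly F (y ^ p ^ n)).coeff i)) :
    IsSeparable F' y := by
  have : ExpChar Ω p := expChar_of_injective_algebraMap (algebraMap F' Ω).injective p
  set g := minpoly F (y ^ p ^ n)
  have hg : (g.map (algebraMap F F')) ∈ Polynomial.lifts (iterateFrobenius F' p n) := by
    rw [Polynomial.lifts_iff_coeff_lifts]
    intro i
    obtain ⟨c, hc⟩ := hcoeff i
    exact ⟨c, by simpa [iterateFrobenius_def] using hc⟩
  obtain ⟨h, hh⟩ := hg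
  have hh : h.map (iterateFrobenius F' p n) = g.map (algebraMap F F') := hh
  have hs : h.Separable := by
    rw [← separable_map (iterateFrobenius F' p n), hh, separable_map]
    exact hsep
  have h0 : aeval y h = 0 := by
    have h1 : (aeval y h) ^ p ^ n = 0 := by
      rw [← iterateFrobenius_def, aeval_def, hom_eval₂]
      have : (iterateFrobenius Ω p n).comp (algebraMap F' Ω) =
          (algebraMap F' Ω).comp (iterateFrobenius F' p n) := by
        ext; simp [iterateFrobenius_def]
      rw [this, ← eval₂_map, hh, eval₂_map, ← IsScalarTower.algebraMap_eq, iterateFrobenius_def]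
      exact minpoly.aeval F _
    exact pow_eq_zero_iff (pow_ne_zero _ (expChar_pos F' p).ne') |>.mp h1
  exact hs.of_dvd (minpoly.dvd _ _ h0)

/-- Finitely many elements of a finite extension all become separable after raising them to one
common power of the characteristic exponent. -/
theorem exists_forall_isSeparable_pow (F : Type*) {L : Type*} [Field F] [Field L] [Algebra F L]
    [FiniteDimensional F L] (p : ℕ) [ExpChar F p] (S : Set L) (hS : S.Finite) :
    ∃ n, ∀ y ∈ S, IsSeparable F (y ^ p ^ n) := by
  have : ExpChar (separableClosure F L) p :=
    expChar_of_injective_algebraMap (algebraMap F (separableClosure F L)).injective p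
  choose n hn using fun y : L => IsPurelyInseparable.pow_mem (separableClosure F L) p y
  obtain ⟨N, hN⟩ := (hS.image n).bddAbove
  refine ⟨N, fun y hy => ?_⟩
  obtain ⟨m, hm⟩ := Nat.exists_eq_add_of_le (hN ⟨y, hy, rfl⟩)
  obtain ⟨z, hz⟩ := hn y
  rw [hm, pow_add, pow_mul, ← hz]
  exact mem_separableClosure_iff.mp (pow_mem z.2 _)

/-- Finiteness of the integral closure can be checked after enlarging the base ring finitely and the
extension arbitrarily. -/
theorem Module.Finite.integralClosure_of_algHom {P P' L L' : Type*} [CommRing P] [CommRing P']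
    [CommRing L] [CommRing L'] [Algebra P P'] [Algebra P L] [Algebra P' L'] [Algebra P L']
    [IsScalarTower P P' L'] [IsNoetherianRing P] [Module.Finite P P']
    [Module.Finite P' (integralClosure P' L')] (ι : L →ₐ[P] L') (hι : Function.Injective ι) :
    Module.Finite P (integralClosure P L) := by
  have : Module.Finite P (integralClosure P' L') := .trans P' _
  let ψ : integralClosure P L →ₗ[P] integralClosure P' L' :=
    { toFun x := ⟨ι x, (x.2.map ι).tower_top⟩
      map_add' x y := by ext; simp
      map_smul' c x := by ext; simp }
  exact Module.Finite.of_injective ψ fun x y h => Subtype.ext (hι congr(($h : L')))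

namespace MvPolynomial

/-- The integral closure of a polynomial ring over a field in a finite, possibly inseparable,
extension of its fraction field is finite. For a large power `q` of the characteristic exponent,
adjoining to `k` the `q`-th roots of finitely many coefficients and replacing the variables by their
`q`-th roots makes the extension separable, and the separable case is
`IsIntegralClosure.finite`. -/
theorem finite_integralClosure {σ : Type*} [Finite σ] (k : Type u) [Field k] (F L : Type*) [Field F]
    [Field L] [Algebra (MvPolynomial σ k) F] [IsFractionRing (MvPolynomial σ k) F] [Algebra F L]
    [Algebra (MvPolynomial σ k) L] [IsScalarTower (MvPolynomial σ k) F L] [FiniteDimensional F L] :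
    Module.Finite (MvPolynomial σ k) (integralClosure (MvPolynomial σ k) L) := by
  obtain ⟨p, hp⟩ := ExpChar.exists k
  have : ExpChar F p := expChar_of_injective_algebraMap
    (IsFractionRing.injective (MvPolynomial σ k) F) p
  let b := Module.finBasis F L
  obtain ⟨n, hn⟩ := exists_forall_isSeparable_pow F p (Set.range b) (Set.finite_range b)
  have hq : 0 < p ^ n := pow_pos (expChar_pos k p) _
  choose num den hden hnd using fun c : F => IsFractionRing.div_surjective (A := MvPolynomial σ k) c
  -- `T` consists of the coefficients of the numerators and denominators of the coefficients of the
  -- minimal polynomials.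
  let C : Set F := ⋃ i, ((minpoly F (b i ^ p ^ n)).coeffs : Set F)
  have hC : C.Finite := Set.finite_iUnion fun i => Finset.finite_toSet _
  let T : Set k := ⋃ c ∈ C, ((num c).coeffs ∪ (den c).coeffs : Set k)
  have hT : T.Finite := hC.biUnion fun c _ => (Finset.finite_toSet _).union (Finset.finite_toSet _)
  obtain ⟨k', _, _, _, hk'⟩ := exists_finite_extension_forall_mem_exists_pow_eq k hq T hT
  have : ExpChar k' p := expChar_of_injective_algebraMap (algebraMap k k').injective p
  algebraize [mapExpand σ k k' (p ^ n)]
  have hfin : Module.Finite (MvPolynomial σ k) (MvPolynomial σ k') := mapExpand_finite hq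
  let F' := FractionRing (MvPolynomial σ k')
  have : ExpChar F' p := expChar_of_injective_algebraMap
    (IsFractionRing.injective (MvPolynomial σ k') F') p
  have hinj : Function.Injective (algebraMap (MvPolynomial σ k) F') :=
    (IsFractionRing.injective (MvPolynomial σ k') F').comp (mapExpand_injective hq)
  let : Algebra F F' := (IsFractionRing.lift hinj).toAlgebra
  have : IsScalarTower (MvPolynomial σ k) F F' := .of_algebraMap_eq fun x =>
    (IsFractionRing.lift_algebraMap hinj x).symm
  let Ω := AlgebraicClosure F'
  let ι : L →ₐ[F] Ω := IsAlgClosed.lift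
  let L' := IntermediateField.adjoin F' (Set.range fun i => ι (b i))
  have hroot (c : F) (hc : c ∈ C) : ∃ d : F', d ^ p ^ n = algebraMap F F' c := by
    have h (f : MvPolynomial σ k) (hf : ∀ a ∈ f.coeffs, a ∈ T) :
        ∃ d : F', d ^ p ^ n = algebraMap (MvPolynomial σ k) F' f := by
      obtain ⟨g, hg⟩ := exists_pow_eq_mapExpand (k' := k') p n f fun d hd =>
        hk' _ (hf _ (coeff_mem_coeffs d (mem_support_iff.mp hd)))
      exact ⟨algebraMap _ F' g, by rw [← map_pow, hg]; rfl⟩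
    obtain ⟨d₁, h₁⟩ := h (num c) fun a ha => Set.mem_biUnion hc (Or.inl ha)
    obtain ⟨d₂, h₂⟩ := h (den c) fun a ha => Set.mem_biUnion hc (Or.inr ha)
    refine ⟨d₁ / d₂, ?_⟩
    rw [div_pow, h₁, h₂, ← congrArg (algebraMap F F') (hnd c), map_div₀,
      ← IsScalarTower.algebraMap_apply, ← IsScalarTower.algebraMap_apply]
  have hsep (i) : IsSeparable F' (ι (b i)) := by
    have hmp : minpoly F (ι (b i) ^ p ^ n) = minpoly F (b i ^ p ^ n) := by
      rw [← map_pow]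
      exact minpoly.algHom_eq ι ι.injective _
    apply Polynomial.Separable.isSeparable_of_pow (F := F) p n
    · rw [IsSeparable, hmp]
      exact hn _ ⟨i, rfl⟩
    · intro j
      rw [hmp]
      by_cases hj : (minpoly F (b i ^ p ^ n)).coeff j = 0
      · exact ⟨0, by rw [hj, map_zero, zero_pow hq.ne']⟩
      · exact hroot _ (Set.mem_iUnion.mpr ⟨i, Polynomial.coeff_mem_coeffs hj⟩)
  have : FiniteDimensional F' L' := IntermediateField.finiteDimensional_adjoin fun x _ =>
      Algebra.IsIntegral.isIntegral x
  have : Algebra.IsSeparable F' L' :=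
    (IntermediateField.isSeparable_adjoin_iff_isSeparable _ _).2 <| by
      rintro _ ⟨i, rfl⟩
      exact hsep i
  have hmem (x : L) : ι x ∈ L' := by
    rw [← b.sum_repr x, map_sum]
    refine sum_mem fun i _ => ?_
    rw [map_smul, Algebra.smul_def, IsScalarTower.algebraMap_apply F F' Ω]
    exact mul_mem (L'.algebraMap_mem _) (IntermediateField.subset_adjoin _ _ ⟨i, rfl⟩)
  have := IsIntegralClosure.finite (MvPolynomial σ k') F' L'
    (integralClosure (MvPolynomial σ k') L')
  let ι' : L →ₐ[MvPolynomial σ k] L' :=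
    { toRingHom := ι.toRingHom.codRestrict L'.toSubfield hmem
      commutes' x := by
        ext
        change ι (algebraMap _ L x) = algebraMap _ Ω x
        rw [IsScalarTower.algebraMap_apply _ F L, AlgHom.commutes,
          IsScalarTower.algebraMap_apply F F' Ω, ← IsScalarTower.algebraMap_apply _ F F']
        rfl }
  have : IsScalarTower (MvPolynomial σ k) (MvPolynomial σ k') L' := .of_algebraMap_eq fun x => rfl
  exact .integralClosure_of_algHom (P' := MvPolynomial σ k') ι' ι'.injective

end MvPolynomial

/-- The integral closure of a domain of finite type over a field in a finite extension of its
fraction field is finite. Noether normalization reduces this to polynomial rings. -/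
theorem finite_integralClosure_of_finiteType (k : Type u) {A : Type*} (F L : Type*) [Field k]
    [CommRing A] [IsDomain A] [Algebra k A] [Algebra.FiniteType k A] [Field F] [Field L]
    [Algebra A F] [IsFractionRing A F] [Algebra A L] [Algebra F L] [IsScalarTower A F L]
    [FiniteDimensional F L] :
    Module.Finite A (integralClosure A L) := by
  obtain ⟨s, g, hg, hg'⟩ := exists_finite_inj_algHom_of_fg k A
  let φ : MvPolynomial (Fin s) k →+* A := g.toRingHom
  have hφ : Function.Injective φ := hg
  have hφ' : φ.Finite := hg'
  algebraize [φ]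
  let : Algebra (MvPolynomial (Fin s) k) L := ((algebraMap A L).comp φ).toAlgebra
  have : IsScalarTower (MvPolynomial (Fin s) k) A L := .of_algebraMap_eq' rfl
  let F₀ := FractionRing (MvPolynomial (Fin s) k)
  let : Algebra (MvPolynomial (Fin s) k) F := ((algebraMap A F).comp φ).toAlgebra
  have : IsScalarTower (MvPolynomial (Fin s) k) A F := .of_algebraMap_eq' rfl
  have hinj : Function.Injective (algebraMap (MvPolynomial (Fin s) k) F) :=
    (IsFractionRing.injective A F).comp hφ
  let : Algebra F₀ F := (IsFractionRing.lift hinj).toAlgebra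
  have : IsScalarTower (MvPolynomial (Fin s) k) F₀ F := .of_algebraMap_eq fun x =>
    (IsFractionRing.lift_algebraMap hinj x).symm
  have : FaithfulSMul (MvPolynomial (Fin s) k) A :=
    (faithfulSMul_iff_algebraMap_injective _ _).mpr hφ
  have : IsLocalization
      (Algebra.algebraMapSubmonoid A (nonZeroDivisors (MvPolynomial (Fin s) k))) F := inferInstance
  have : FiniteDimensional F₀ F :=
    .of_isLocalization (MvPolynomial (Fin s) k) A (nonZeroDivisors (MvPolynomial (Fin s) k))
  let : Algebra F₀ L := ((algebraMap F L).comp (algebraMap F₀ F)).toAlgebra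
  have : IsScalarTower F₀ F L := .of_algebraMap_eq' rfl
  have : IsScalarTower (MvPolynomial (Fin s) k) F₀ L := .of_algebraMap_eq fun x => by
    change _ = algebraMap F L (algebraMap F₀ F _)
    rw [← IsScalarTower.algebraMap_apply _ F₀ F, IsScalarTower.algebraMap_apply _ A L,
      IsScalarTower.algebraMap_apply A F L, ← IsScalarTower.algebraMap_apply _ A F]
  have : FiniteDimensional F₀ L := .trans F₀ F L
  have := MvPolynomial.finite_integralClosure (σ := Fin s) k F₀ L
  have h : Module.Finite (MvPolynomial (Fin s) k) (integralClosure A L) := by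
    have : (integralClosure A L).restrictScalars (MvPolynomial (Fin s) k) =
        integralClosure (MvPolynomial (Fin s) k) L := by
      ext x
      exact ⟨fun h => isIntegral_trans x h, fun h => h.tower_top⟩
    let e : integralClosure (MvPolynomial (Fin s) k) L ≃ₗ[MvPolynomial (Fin s) k]
        integralClosure A L :=
      (Subalgebra.equivOfEq _ _ this.symm).toLinearEquiv
    exact .equiv e
  exact .of_restrictScalars_finite (MvPolynomial (Fin s) k) _ _

/-! ### Fields with many specializations are geometrically integral -/

open TensorProduct in
/-- If every finitely generated `K`-subalgebra of the field `L` has a `K`-rational point, then `L`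
stays a domain after every extension of `K`. Two nonzero elements of `L ⊗ K'` with product zero
would have coefficients in a finitely generated subalgebra `A`, and a suitable homomorphism `A → K`
would specialize them to nonzero elements of the field `K'` with product zero. -/
theorem noZeroDivisors_tensorProduct_of_forall_nonempty_algHom {K L K' : Type*} [Field K] [Field L]
    [Field K'] [Algebra K L] [Algebra K K']
    (h : ∀ A : Subalgebra K L, A.FG → Nonempty (A →ₐ[K] K)) : NoZeroDivisors (L ⊗[K] K') := by
  let c := Module.Basis.ofVectorSpace K K'
  refine ⟨fun {f g} hfg => ?_⟩
  by_contra! hne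
  obtain ⟨a, ha⟩ := TensorProduct.eq_repr_basis_right c f
  obtain ⟨b, hb⟩ := TensorProduct.eq_repr_basis_right c g
  obtain ⟨i₀, hi₀⟩ : ∃ i, a i ≠ 0 := by
    by_contra! h0
    exact hne.1 (by rw [← ha, show a = 0 from Finsupp.ext h0, Finsupp.sum_zero_index])
  obtain ⟨j₀, hj₀⟩ : ∃ j, b j ≠ 0 := by
    by_contra! h0
    exact hne.2 (by rw [← hb, show b = 0 from Finsupp.ext h0, Finsupp.sum_zero_index])
  -- Adjoining the inverses forces the specializations of `a i₀` and `b j₀` to be nonzero.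
  let A : Subalgebra K L :=
    Algebra.adjoin K (((Set.range a ∪ Set.range b) ∪ {(a i₀)⁻¹, (b j₀)⁻¹}))
  have hA : A.FG := Subalgebra.fg_def.mpr ⟨_, (a.finite_range.union b.finite_range).union
    (Set.toFinite _), rfl⟩
  have haA (i) : a i ∈ A := Algebra.subset_adjoin (.inl (.inl ⟨i, rfl⟩))
  have hbA (i) : b i ∈ A := Algebra.subset_adjoin (.inl (.inr ⟨i, rfl⟩))
  obtain ⟨φ⟩ := h A hA
  have hunit (x : A) (hx : (x : L) ≠ 0) (hx' : (x : L)⁻¹ ∈ A) : φ x ≠ 0 := by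
    have : x * ⟨_, hx'⟩ = 1 := Subtype.ext (mul_inv_cancel₀ hx)
    exact left_ne_zero_of_mul_eq_one (by rw [← map_mul, this, map_one] :
      φ x * φ ⟨_, hx'⟩ = 1)
  have ha₀ : φ ⟨a i₀, haA i₀⟩ ≠ 0 := hunit _ hi₀ (Algebra.subset_adjoin (.inr (.inl rfl)))
  have hb₀ : φ ⟨b j₀, hbA j₀⟩ ≠ 0 := hunit _ hj₀ (Algebra.subset_adjoin (.inr (.inr rfl)))
  let ι : A ⊗[K] K' →ₐ[K] L ⊗[K] K' := Algebra.TensorProduct.map A.val (AlgHom.id K K')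
  have hι : Function.Injective ι :=
    Module.Flat.rTensor_preserves_injective_linearMap A.val.toLinearMap Subtype.val_injective
  let ψ : A ⊗[K] K' →ₐ[K] K' :=
    Algebra.TensorProduct.productMap ((Algebra.ofId K K').comp φ) (AlgHom.id K K')
  have key (d : Module.Basis.ofVectorSpaceIndex K K' →₀ L) (hd : ∀ i, d i ∈ A) (i)
      (hi : φ ⟨d i, hd i⟩ ≠ 0) : ∃ x, ι x = d.sum (fun i m => m ⊗ₜ[K] c i) ∧ ψ x ≠ 0 := by
    refine ⟨∑ j ∈ d.support, (⟨d j, hd j⟩ : A) ⊗ₜ[K] c j, by simp [ι, Finsupp.sum],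
      fun h0 => hi ?_⟩
    have h1 : ∑ j ∈ d.support, φ ⟨d j, hd j⟩ • c j = 0 := by
      rw [← h0, map_sum]
      simp [ψ, Algebra.smul_def, Algebra.ofId_apply]
    have hi' : i ∈ d.support := by
      rw [Finsupp.mem_support_iff]
      rintro h
      exact hi (by rw [show (⟨d i, hd i⟩ : A) = 0 from Subtype.ext h, map_zero])
    exact linearIndependent_iff'.mp c.linearIndependent _ _ h1 i hi'
  obtain ⟨x, hx, hx'⟩ := key a haA i₀ ha₀
  obtain ⟨y, hy, hy'⟩ := key b hbA j₀ hb₀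
  have hxy : x * y = 0 := hι (by rw [map_mul, hx, hy, ha, hb, hfg, map_zero])
  exact mul_ne_zero hx' hy' (by rw [← map_mul, hxy, map_zero])

/-! ### Normalization in an extension of the function field -/

namespace AlgebraicGeometry

variable (X : Scheme.{u}) [IsIntegral X] (L : Type u) [Field L] [Algebra X.functionField L]

/-- The effect on sections of a morphism `Spec R ⟶ Spec 𝒪_{X,x} ⟶ X`. -/
theorem SpecMap_fromSpecStalk_app {X : Scheme.{u}} {x : X} {R : CommRingCat.{u}}
    (φ : X.presheaf.stalk x ⟶ R) {U : X.Opens} (hxU : x ∈ U)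
    (h : ⊤ ≤ (Spec.map φ ≫ X.fromSpecStalk x) ⁻¹ᵁ U) :
    (Spec.map φ ≫ X.fromSpecStalk x).app U ≫ (Spec R).presheaf.map (homOfLE h).op ≫
      (Scheme.ΓSpecIso R).hom = X.presheaf.germ U x hxU ≫ φ := by
  change (Spec.map φ ≫ X.fromSpecStalk x).appLE U ⊤ h ≫ _ = _
  have h1 : ⊤ ≤ X.fromSpecStalk x ⁻¹ᵁ U := by
    intro z _
    exact ((IsLocalRing.specializes_closedPoint z).map (X.fromSpecStalk x).continuous).mem_open
      U.isOpen (by simpa using hxU)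
  rw [← Scheme.Hom.appLE_comp_appLE _ _ U ⊤ ⊤ h1 le_top]
  have h2 : (Spec.map φ).appLE ⊤ ⊤ le_top ≫ (Scheme.ΓSpecIso R).hom =
      (Scheme.ΓSpecIso _).hom ≫ φ := by
    rw [← Scheme.ΓSpecIso_naturality]
    exact congr($(Scheme.Hom.appLE_eq_app _) ≫ _)
  have h3 : (X.fromSpecStalk x).appLE U ⊤ h1 =
      X.presheaf.germ U x hxU ≫ (Scheme.ΓSpecIso _).inv := by
    rw [Scheme.Hom.appLE, Scheme.fromSpecStalk_app hxU, Category.assoc, Category.assoc,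
      ← Functor.map_comp, Subsingleton.elim (_ ≫ _) (𝟙 _), CategoryTheory.Functor.map_id,
      Category.comp_id]
  rw [Category.assoc, h2, h3, Category.assoc, Iso.inv_hom_id_assoc]

/-- The inclusion of the function field of `X` in an extension, as a morphism in `CommRingCat`. -/
noncomputable def functionFieldToExtension : X.presheaf.stalk (genericPoint X) ⟶ .of L :=
  CommRingCat.ofHom (algebraMap X.functionField L)

/-- The morphism `Spec L ⟶ X` through the generic point given by a field extension `L` of the
function field. -/
noncomputable def fromSpecExtension : Spec (.of L) ⟶ X :=
  Spec.map (functionFieldToExtension X L) ≫ X.fromSpecStalk (genericPoint X)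

@[simp]
theorem fromSpecExtension_apply (x : Spec (.of L)) : fromSpecExtension X L x = genericPoint X := by
  have : Spec.map (functionFieldToExtension X L) x =
      IsLocalRing.closedPoint (X.presheaf.stalk (genericPoint X)) :=
    Subsingleton.elim (α := PrimeSpectrum X.functionField) _ _
  rw [fromSpecExtension, Scheme.Hom.comp_apply, this, Scheme.fromSpecStalk_closedPoint]

instance [X.IsSeparated] : IsAffineHom (fromSpecExtension X L) :=
  .of_comp _ (Limits.terminal.from X)

variable {X} in
theorem fromSpecExtension_preimage (U : X.Opens) [Nonempty U] :
    fromSpecExtension X L ⁻¹ᵁ U = ⊤ := by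
  ext x
  simpa using ((genericPoint_spec X).mem_open_set_iff U.isOpen).mpr (by simpa using ‹Nonempty U›)

/-- The sections over a nonempty open subset of `X` of the push-forward of the structure sheaf of
`Spec L`, identified with `L`. -/
noncomputable def fromSpecExtensionAppIso (U : X.Opens) [Nonempty U] :
    Γ(Spec (.of L), fromSpecExtension X L ⁻¹ᵁ U) ≅ .of L :=
  (Spec (.of L)).presheaf.mapIso (eqToIso (fromSpecExtension_preimage L U).symm).op ≪≫
    Scheme.ΓSpecIso _

theorem fromSpecExtension_app (U : X.Opens) [Nonempty U] :
    (fromSpecExtension X L).app U ≫ (fromSpecExtensionAppIso X L U).hom =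
      X.germToFunctionField U ≫ functionFieldToExtension X L :=
  SpecMap_fromSpecStalk_app _ _ (fromSpecExtension_preimage L U).ge

variable {X} in
theorem exists_algebra_isScalarTower (U : X.Opens) [Nonempty U] :
    ∃ _ : Algebra Γ(X, U) L, IsScalarTower Γ(X, U) X.functionField L :=
  let := ((algebraMap X.functionField L).comp (algebraMap Γ(X, U) X.functionField)).toAlgebra
  ⟨this, .of_algebraMap_eq' rfl⟩

/-- The normalization of an integral scheme `X` in an extension `L` of its function field: the
relative normalization of `X` in `Spec L`. -/
noncomputable abbrev normalizationIn [X.IsSeparated] : Scheme.{u} :=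
  (fromSpecExtension X L).normalization

/-- The projection of the normalization of `X` in `L` to `X`. -/
noncomputable abbrev fromNormalizationIn [X.IsSeparated] : normalizationIn X L ⟶ X :=
  (fromSpecExtension X L).fromNormalization

/-- Over an affine open subset `U` the normalization in `L` is the spectrum of the integral closure
of `Γ(X, U)` in `L`. -/
theorem exists_ringEquiv_normalizationIn [X.IsSeparated] (U : X.Opens) (hU : IsAffineOpen U)
    [Nonempty U] [Algebra Γ(X, U) L] [IsScalarTower Γ(X, U) X.functionField L] :
    ∃ e : Γ(normalizationIn X L, fromNormalizationIn X L ⁻¹ᵁ U) ≃+* integralClosure Γ(X, U) L,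
      ∀ a, e ((fromNormalizationIn X L).app U a) = algebraMap _ _ a := by
  let := ((fromSpecExtension X L).app U).hom.toAlgebra
  let e₁ : Γ(Spec (.of L), fromSpecExtension X L ⁻¹ᵁ U) ≃ₐ[Γ(X, U)] L :=
    { (fromSpecExtensionAppIso X L U).commRingCatIsoToRingEquiv with
      commutes' a := by
        have := congr($(fromSpecExtension_app X L U) a)
        rw [IsScalarTower.algebraMap_apply _ X.functionField L]
        exact this }
  refine ⟨((fromSpecExtension X L).normalizationObjIso hU).commRingCatIsoToRingEquiv.trans
    e₁.mapIntegralClosure.toRingEquiv, fun a => ?_⟩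
  rw [Scheme.Hom.fromNormalization_app _ hU]
  change e₁.mapIntegralClosure (_ : integralClosure Γ(X, U) _) = _
  trans e₁.mapIntegralClosure (algebraMap Γ(X, U) _ a)
  · congr 1
    exact congr($(((fromSpecExtension X L).normalizationObjIso hU).inv_hom_id) (algebraMap _ _ a))
  · exact e₁.mapIntegralClosure.commutes a

variable [X.IsSeparated]

theorem surjective_fromNormalizationIn : Surjective (fromNormalizationIn X L) := by
  have : IsDominant (fromNormalizationIn X L) := by
    refine ⟨?_⟩
    have h : genericPoint X ∈ Set.range (fromNormalizationIn X L) := by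
      obtain ⟨x⟩ : Nonempty (Spec (.of L)) := inferInstance
      exact ⟨(fromSpecExtension X L).toNormalization x, by
        rw [← Scheme.Hom.comp_apply, Scheme.Hom.toNormalization_fromNormalization,
          fromSpecExtension_apply]⟩
    exact dense_iff_closure_eq.mpr (Set.eq_univ_of_univ_subset (by
      rw [← (genericPoint_spec X).def]
      exact closure_mono (Set.singleton_subset_iff.mpr h)))
  exact ⟨Set.range_eq_univ.mp <| by
    rw [← (fromNormalizationIn X L).isClosedMap.isClosed_range.closure_eq]
    exact (fromNormalizationIn X L).denseRange.closure_range⟩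

theorem isFinite_fromNormalizationIn [FiniteDimensional X.functionField L] {k : Type u} [Field k]
    (p : X ⟶ Spec (.of k)) [LocallyOfFiniteType p] : IsFinite (fromNormalizationIn X L) := by
  refine ⟨fun U hU => ?_⟩
  rcases isEmpty_or_nonempty U with h | h
  · have : Subsingleton Γ(normalizationIn X L, fromNormalizationIn X L ⁻¹ᵁ U) := by
      obtain rfl : U = ⊥ := by
        ext x
        exact ⟨fun hx => h.elim ⟨x, hx⟩, False.elim⟩
      change Subsingleton Γ(normalizationIn X L, ⊥)
      infer_instance
    exact .of_surjective _ fun x => ⟨0, Subsingleton.elim _ _⟩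
  obtain ⟨_, _⟩ := exists_algebra_isScalarTower L U
  obtain ⟨e, he⟩ := exists_ringEquiv_normalizationIn X L U hU
  have := functionField_isFractionRing_of_isAffineOpen X U hU
  have hp : (p.appLE ⊤ U le_top).hom.FiniteType := p.finiteType_appLE (isAffineOpen_top _) hU _
  let φ : k →+* Γ(X, U) := (p.appLE ⊤ U le_top).hom.comp (Scheme.ΓSpecIso (.of k)).inv.hom
  have hφ : φ.FiniteType := RingHom.FiniteType.comp hp
    (.of_surjective _ (Scheme.ΓSpecIso (.of k)).symm.commRingCatIsoToRingEquiv.surjective)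
  algebraize [φ]
  have := finite_integralClosure_of_finiteType k (A := Γ(X, U)) X.functionField L
  have h1 : ((fromNormalizationIn X L).app U).hom =
      e.symm.toRingHom.comp (algebraMap Γ(X, U) (integralClosure Γ(X, U) L)) := by
    ext a
    exact (e.symm_apply_eq.mpr (he a).symm).symm
  rw [h1]
  exact RingHom.Finite.comp (.of_surjective _ e.symm.surjective)
    (RingHom.finite_algebraMap.mpr this)

theorem isNormal_normalizationIn [FiniteDimensional X.functionField L] :
    HilbertProp.IsNormal (normalizationIn X L) := by
  intro x
  refine ⟨inferInstance, ?_⟩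
  obtain ⟨U, hU, hxU⟩ : ∃ U : X.Opens, IsAffineOpen U ∧ fromNormalizationIn X L x ∈ U := by
    obtain ⟨U, hU, hx, -⟩ := exists_isAffineOpen_mem_and_subset
      (TopologicalSpace.Opens.mem_top (fromNormalizationIn X L x))
    exact ⟨U, hU, hx⟩
  have : Nonempty U := ⟨⟨_, hxU⟩⟩
  obtain ⟨_, _⟩ := exists_algebra_isScalarTower L U
  obtain ⟨e, -⟩ := exists_ringEquiv_normalizationIn X L U hU
  have := functionField_isFractionRing_of_isAffineOpen X U hU
  have hV := hU.preimage (fromNormalizationIn X L)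
  have := integralClosure.isIntegrallyClosedOfFiniteExtension (R := Γ(X, U)) X.functionField
    (L := L)
  have : IsIntegrallyClosed Γ(normalizationIn X L, fromNormalizationIn X L ⁻¹ᵁ U) :=
    .of_equiv e.symm
  have : Nonempty (fromNormalizationIn X L ⁻¹ᵁ U) := ⟨⟨x, hxU⟩⟩
  let : Algebra Γ(normalizationIn X L, fromNormalizationIn X L ⁻¹ᵁ U)
      ((normalizationIn X L).presheaf.stalk x) :=
    TopCat.Presheaf.algebra_section_stalk _ (⟨x, hxU⟩ : fromNormalizationIn X L ⁻¹ᵁ U)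
  have := hV.isLocalization_stalk ⟨x, hxU⟩
  exact isIntegrallyClosed_of_isLocalization _
    (hV.primeIdealOf ⟨x, hxU⟩).asIdeal.primeCompl (Ideal.primeCompl_le_nonZeroDivisors _)

theorem degree_fromNormalizationIn [FiniteDimensional X.functionField L]
    [IsDominant (fromNormalizationIn X L)] :
    HilbertProp.degree (fromNormalizationIn X L) = Module.finrank X.functionField L := by
  obtain ⟨U, hU, hηU⟩ : ∃ U : X.Opens, IsAffineOpen U ∧ genericPoint X ∈ U := by
    obtain ⟨U, hU, hη, -⟩ := exists_isAffineOpen_mem_and_subset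
      (TopologicalSpace.Opens.mem_top (genericPoint X))
    exact ⟨U, hU, hη⟩
  have : Nonempty U := ⟨⟨_, hηU⟩⟩
  obtain ⟨_, _⟩ := exists_algebra_isScalarTower L U
  obtain ⟨e, he⟩ := exists_ringEquiv_normalizationIn X L U hU
  have := functionField_isFractionRing_of_isAffineOpen X U hU
  have hV := hU.preimage (fromNormalizationIn X L)
  have := integralClosure.isFractionRing_of_finite_extension (A := Γ(X, U)) X.functionField L
  have hηV : genericPoint (normalizationIn X L) ∈ fromNormalizationIn X L ⁻¹ᵁ U := by
    change fromNormalizationIn X L _ ∈ U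
    rwa [HilbertProp.map_genericPoint]
  have : Nonempty (fromNormalizationIn X L ⁻¹ᵁ U) := ⟨⟨_, hηV⟩⟩
  have := functionField_isFractionRing_of_isAffineOpen _ _ hV
  let j : (normalizationIn X L).functionField ≃+* L := IsFractionRing.ringEquivOfRingEquiv e
  let := (HilbertProp.functionFieldMap (fromNormalizationIn X L)).hom.toAlgebra
  refine Algebra.finrank_eq_of_equiv_equiv (RingEquiv.refl _) j ?_
  refine IsLocalization.ringHom_ext (nonZeroDivisors Γ(X, U)) (RingHom.ext fun a => ?_)
  have h1 : HilbertProp.functionFieldMap (fromNormalizationIn X L) (X.germToFunctionField U a) =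
      (normalizationIn X L).germToFunctionField _ ((fromNormalizationIn X L).app U a) := by
    simp only [HilbertProp.functionFieldMap, ← CommRingCat.comp_apply, Scheme.germToFunctionField,
      TopCat.Presheaf.germ_stalkSpecializes_assoc, Scheme.Hom.germ_stalkMap]
  change algebraMap X.functionField L (algebraMap Γ(X, U) X.functionField a) =
    j (HilbertProp.functionFieldMap (fromNormalizationIn X L) (X.germToFunctionField U a))
  rw [h1, ← IsScalarTower.algebraMap_apply]
  change _ = j (algebraMap _ _ _)
  rw [IsFractionRing.ringEquivOfRingEquiv_algebraMap, he]
  rfl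

/-- The normalization is geometrically integral if `L` is: each of its base changes receives a
scheme-theoretically dominant morphism from the base change of `Spec L`. -/
theorem geometricallyIntegral_normalizationIn {k : Type u} [Field k] (p : X ⟶ Spec (.of k))
    [GeometricallyIntegral (fromSpecExtension X L ≫ p)] :
    GeometricallyIntegral (fromNormalizationIn X L ≫ p) := by
  refine ⟨?_⟩
  intro K _ y Z fst snd hZ
  let π := fromNormalizationIn X L ≫ p
  let t := (fromSpecExtension X L).toNormalization
  let q := Limits.pullback.snd t fst
  have h : IsPullback (Limits.pullback.fst t fst) (q ≫ snd) (t ≫ π) y :=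
    ((IsPullback.of_hasPullback t fst).flip.paste_horiz hZ.flip).flip
  have ht : t ≫ π = fromSpecExtension X L ≫ p := by
    simp [t, π, ← Category.assoc]
  rw [ht] at h
  have : IsIntegral (Limits.pullback t fst) :=
    GeometricallyIntegral.geometrically_isIntegral (f := fromSpecExtension X L ≫ p) _ _ _ h
  have : IsSchemeTheoreticallyDominant t := .of_isDominant t
  have : Flat fst := MorphismProperty.of_isPullback hZ.flip inferInstance
  have := IsSchemeTheoreticallyDominant.isReduced q
  have : IrreducibleSpace Z := by
    rw [irreducibleSpace_def]
    change IsIrreducible Set.univ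
    rw [← q.denseRange.closure_range, ← Set.image_univ]
    exact ((IrreducibleSpace.isIrreducible_univ _).image _ q.continuous.continuousOn).closure
  exact isIntegral_of_irreducibleSpace_of_isReduced _

end AlgebraicGeometry

/-! ### Generically finite morphisms and spreading out -/

namespace AlgebraicGeometry

theorem discreteTopology_fiber_of_finite {X Y : Scheme.{u}} (f : Y ⟶ X) [LocallyOfFiniteType f]
    {x : X} (h : (f ⁻¹' {x}).Finite) : DiscreteTopology (f.fiber x) := by
  have : Finite (f.fiber x) := by
    have := h.to_subtype
    exact .of_equiv _ (f.fiberHomeo x).symm.toEquiv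
  have : LocallyQuasiFinite (f.fiberToSpecResidueField x) :=
    have : LocallyOfFiniteType (f.fiberToSpecResidueField x) :=
      inferInstanceAs (LocallyOfFiniteType (Limits.pullback.snd _ _))
    .of_finite_preimage_singleton _ fun _ => Set.toFinite _
  have := IsLocallyArtinian.of_locallyQuasiFinite (f.fiberToSpecResidueField x)
  infer_instance

theorem isDiscrete_preimage_singleton_of_finite {X Y : Scheme.{u}} (f : Y ⟶ X)
    [LocallyOfFiniteType f] {x : X} (h : (f ⁻¹' {x}).Finite) : _root_.IsDiscrete (f ⁻¹' {x}) := by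
  have := discreteTopology_fiber_of_finite f h
  simpa [Scheme.Hom.range_fiberι] using
    (isDiscrete_univ_iff.mpr inferInstance).image (f.fiberι x).isEmbedding.toIsInducing

/-- If `f : Y ⟶ X` has finite generic fibre, the local ring of `Y` at a maximal point `y` over the
generic point of `X` is a finite extension `L` of the function field. The field `L` is kept apart
from the stalk because the latter carries only a ring structure as an instance. -/
theorem exists_finite_extension_of_isGeneric {X Y : Scheme.{u}} [IsIntegral X] [IsReduced Y]
    (f : Y ⟶ X) [LocallyOfFiniteType f] (h : (f ⁻¹' {genericPoint X}).Finite) {y : Y}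
    (hy : closure {y} ∈ irreducibleComponents Y) (hfy : f y = genericPoint X) :
    ∃ (L : Type u) (_ : Field L) (_ : Algebra X.functionField L)
      (e : Spec (.of L) ≅ Spec (Y.presheaf.stalk y)), FiniteDimensional X.functionField L ∧
        e.hom ≫ Y.fromSpecStalk y ≫ f = fromSpecExtension X L := by
  let := (isField_stalk_of_closure_mem_irreducibleComponents Y y hy).toField
  let φ : X.presheaf.stalk (genericPoint X) ⟶ Y.presheaf.stalk y :=
    X.presheaf.stalkSpecializes (specializes_of_eq hfy) ≫ f.stalkMap y
  let : Algebra X.functionField (Y.presheaf.stalk y) := φ.hom.toAlgebra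
  refine ⟨Y.presheaf.stalk y, inferInstance, inferInstance, Iso.refl _, ?_, ?_⟩
  · have hqf : f.QuasiFiniteAt y := by
      rw [Scheme.Hom.quasiFiniteAt_iff_isOpen_singleton_asFiber]
      have := discreteTopology_fiber_of_finite f (x := f y) (hfy ▸ h)
      exact isOpen_discrete _
    have hqf' : RingHom.QuasiFinite φ.hom :=
      RingHom.QuasiFinite.comp hqf (.of_finite (.of_surjective _ (X.presheaf.stalkCongr
        (Inseparable.of_eq hfy.symm)).commRingCatIsoToRingEquiv.surjective))
    have : Algebra.QuasiFinite X.functionField (Y.presheaf.stalk y) := hqf'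
    exact Module.Finite.of_quasiFinite
  · rw [Iso.refl_hom, Category.id_comp]
    change _ = Spec.map φ ≫ _
    rw [Spec.map_comp, Category.assoc, Scheme.SpecMap_stalkSpecializes_fromSpecStalk,
      Scheme.SpecMap_stalkMap_fromSpecStalk]

/-- A rational section is the same as a section over the generic point. -/
theorem exists_partialMap_section_iff {X Y : Scheme.{u}} [IsIntegral X] (f : Y ⟶ X)
    [LocallyOfFiniteType f] : (∃ ψ : X.PartialMap Y, ψ.hom ≫ f = ψ.domain.ι) ↔
      ∃ s : Spec (X.presheaf.stalk (genericPoint X)) ⟶ Y,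
        s ≫ f = X.fromSpecStalk (genericPoint X) := by
  refine ⟨fun ⟨ψ, hψ⟩ => ?_, fun ⟨s, hs⟩ => ?_⟩
  · have h := (genericPoint_specializes (α := X) _).mem_open ψ.domain.isOpen
      ψ.dense_domain.nonempty.some_mem
    exact ⟨ψ.domain.fromSpecStalkOfMem _ h ≫ ψ.hom, by simp [hψ]⟩
  · obtain ⟨U, hU, ψ, -, hψ⟩ := spread_out_of_isGermInjective' (𝟙 X) f s (by
      rw [hs, Category.comp_id])
    exact ⟨⟨U, U.isOpen.dense ⟨_, hU⟩, ψ⟩, by simpa using hψ⟩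

theorem exists_section_of_finrank_eq_one {X Y : Scheme.{u}} [IsIntegral X] (f : Y ⟶ X)
    [LocallyOfFiniteType f] {L : Type u} [Field L] [Algebra X.functionField L]
    (s : Spec (.of L) ⟶ Y) (hs : s ≫ f = fromSpecExtension X L)
    (h1 : Module.finrank X.functionField L = 1) :
    ∃ ψ : X.PartialMap Y, ψ.hom ≫ f = ψ.domain.ι := by
  have hb : Function.Bijective (algebraMap X.functionField L) := by
    refine ⟨FaithfulSMul.algebraMap_injective _ _, fun l => ?_⟩
    obtain ⟨c, hc⟩ := (finrank_eq_one_iff_of_nonzero' (1 : L) one_ne_zero).mp h1 l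
    exact ⟨c, by rw [Algebra.algebraMap_eq_smul_one, hc]⟩
  have : IsIso (functionFieldToExtension X L) :=
    (ConcreteCategory.isIso_iff_bijective _).mpr hb
  refine (exists_partialMap_section_iff f).mpr
    ⟨inv (Spec.map (functionFieldToExtension X L)) ≫ s, ?_⟩
  rw [Category.assoc, hs, fromSpecExtension, IsIso.inv_hom_id_assoc]

/-- An `S`-morphism from the spectrum of the local ring at `y` extends to a neighbourhood of `y`. -/
theorem exists_spread_out {S Y Z : Scheme.{u}} (f : Y ⟶ S) (g : Z ⟶ S) [LocallyOfFiniteType g]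
    {y : Y} [Y.IsGermInjectiveAt y] {R : CommRingCat.{u}} (e : Spec R ≅ Spec (Y.presheaf.stalk y))
    (φ : Spec R ⟶ Z) (h : φ ≫ g = e.hom ≫ Y.fromSpecStalk y ≫ f) :
    ∃ V : Y.Opens, y ∈ V ∧ ∃ ψ : V.toScheme ⟶ Z, ψ ≫ g = V.ι ≫ f := by
  obtain ⟨V, hV, ψ, -, hψ⟩ := spread_out_of_isGermInjective' f g (e.inv ≫ φ) (by
    rw [Category.assoc, h, Iso.inv_hom_id_assoc])
  exact ⟨V, hV, ψ, hψ⟩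

theorem geometricallyIntegral_SpecMap_of_forall_nonempty_algHom (K L : Type u) [Field K] [Field L]
    [Algebra K L] (h : ∀ A : Subalgebra K L, A.FG → Nonempty (A →ₐ[K] K)) :
    GeometricallyIntegral (Spec.map (CommRingCat.ofHom (algebraMap K L))) := by
  refine ⟨?_⟩
  rw [geometrically_iff_of_commRing]
  intro K' _ _ Z fst snd hZ
  have := noZeroDivisors_tensorProduct_of_forall_nonempty_algHom (K' := K') h
  have : IsDomain (TensorProduct K L K') := NoZeroDivisors.to_isDomain _
  let e : Z ≅ Spec (.of (TensorProduct K L K')) := hZ.isoPullback ≪≫ pullbackSpecIso K L K'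
  have : Nonempty Z := ⟨e.inv (Classical.arbitrary _)⟩
  exact isIntegral_of_isOpenImmersion e.hom

/-- If the local ring of `Y` at `y` is a field and every neighbourhood of `y` contains a rational
point, then this field is geometrically integral over `K`: the spectrum of a finitely generated
subalgebra receives a morphism from a neighbourhood of `y`, hence has a rational point. -/
theorem geometricallyIntegral_of_forall_exists_point {K L : Type u} [Field K] [Field L]
    {Y : Over (Spec (.of K))} {y : Y.left} [Y.left.IsGermInjectiveAt y]
    (e : Spec (.of L) ≅ Spec (Y.left.presheaf.stalk y))
    (h : ∀ V : Y.left.Opens, y ∈ V → ∃ s : HilbertProp.RationalPoints Y,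
      Set.range s.left ⊆ (V : Set Y.left)) :
    GeometricallyIntegral (e.hom ≫ Y.left.fromSpecStalk y ≫ Y.hom) := by
  obtain ⟨φ, hφ⟩ := Spec.map_surjective (e.hom ≫ Y.left.fromSpecStalk y ≫ Y.hom)
  let : Algebra K L := φ.hom.toAlgebra
  rw [← hφ]
  refine geometricallyIntegral_SpecMap_of_forall_nonempty_algHom K L fun A hA => ?_
  let g : Spec (.of A) ⟶ Spec (.of K) := Spec.map (CommRingCat.ofHom (algebraMap K A))
  have : Algebra.FiniteType K A := A.fg_iff_finiteType.mp hA
  have : LocallyOfFiniteType g := by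
    rw [HasRingHomProperty.Spec_iff (P := @LocallyOfFiniteType)]
    exact RingHom.finiteType_algebraMap.mpr this
  obtain ⟨V, hyV, ψ, hψ⟩ := exists_spread_out Y.hom g e
    (Spec.map (CommRingCat.ofHom A.val.toRingHom)) (by
      rw [← hφ, ← Spec.map_comp]
      rfl)
  obtain ⟨s, hs⟩ := h V hyV
  let t : Spec (.of K) ⟶ V := IsOpenImmersion.lift V.ι s.left (by simpa using hs)
  have ht : t ≫ V.ι = s.left := IsOpenImmersion.lift_fac _ _ _
  obtain ⟨χ, hχ⟩ := Spec.map_surjective (t ≫ ψ)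
  have h1 : CommRingCat.ofHom (algebraMap K A) ≫ χ = 𝟙 _ := by
    apply Spec.map_injective
    rw [Spec.map_comp, hχ, Category.assoc]
    change t ≫ ψ ≫ g = _
    rw [hψ, reassoc_of% ht, Over.w s, Spec.map_id]
    rfl
  exact ⟨{ χ.hom with commutes' a := congr($h1 a) }⟩

end AlgebraicGeometry

/-! ### Generic points of Noetherian and irreducible spaces -/

open TopologicalSpace in
/-- The closure of the image of a closed subset `C` of a Noetherian space is the union of the
closures of the images of the finitely many generic points of `C`, so a maximal point `η` outside
the image of `C` is outside its closure. -/
theorem notMem_closure_image_of_forall_ne {X Y : Type*} [TopologicalSpace X] [TopologicalSpace Y]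
    [NoetherianSpace Y] [QuasiSober Y] {f : Y → X} (hf : Continuous f) {C : Set Y}
    (hC : IsClosed C) {η : X} (hη : ∀ x, x ⤳ η → x = η) (h : ∀ c ∈ C, f c ≠ η) :
    η ∉ closure (f '' C) := by
  obtain ⟨S, hS, hirr, hCS⟩ := NoetherianSpace.exists_finite_set_closeds_irreducible
    (⟨C, hC⟩ : Closeds Y)
  have hsub : C = ⋃ t ∈ S, (t : Set Y) := by
    have := congrArg (fun t : Closeds Y => (t : Set Y)) hCS
    simpa [(hS.isClosed_biUnion fun t _ => t.isClosed).closure_eq] using this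
  rw [hsub, Set.image_iUnion₂, hS.closure_biUnion]
  simp only [Set.mem_iUnion, not_exists]
  intro t ht hmem
  obtain ⟨c, hc⟩ := QuasiSober.sober (hirr t ht) t.isClosed
  have hct : c ∈ C := by
    rw [hsub]
    exact Set.mem_biUnion ht hc.mem
  refine h c hct (hη _ ?_)
  rw [specializes_iff_mem_closure]
  refine closure_minimal ?_ isClosed_closure hmem
  rintro _ ⟨z, hz, rfl⟩
  rw [← specializes_iff_mem_closure]
  exact (hc.specializes hz).map hf

theorem exists_ne_genericPoint_of_topologicalKrullDim_pos {X : Type*} [TopologicalSpace X]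
    [QuasiSober X] [IrreducibleSpace X] (h : 0 < topologicalKrullDim X) :
    ∃ x : X, x ≠ genericPoint X := by
  obtain ⟨Z, Z', hZ⟩ := Order.krullDim_pos_iff.mp h
  obtain ⟨x, hx⟩ := Z.2.1
  refine ⟨x, fun h0 => hZ.not_ge fun z _ => ?_⟩
  exact ((genericPoint_spec X).specializes trivial).mem_closed Z.3 (h0 ▸ hx)

theorem topologicalKrullDim_pos_of_ne_genericPoint {X : Type*} [TopologicalSpace X] [T0Space X]
    [QuasiSober X] [IrreducibleSpace X] {x : X} (h : x ≠ genericPoint X) :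
    0 < topologicalKrullDim X := by
  refine Order.krullDim_pos_iff.mpr ⟨⟨closure {x}, isIrreducible_singleton.closure,
    isClosed_closure⟩, ⟨Set.univ, IrreducibleSpace.isIrreducible_univ X, isClosed_univ⟩, ?_⟩
  refine lt_of_le_not_ge (fun _ _ => trivial) fun hle => h ?_
  have h1 : x ⤳ genericPoint X := specializes_iff_mem_closure.mpr (hle (Set.mem_univ _))
  exact (h1.antisymm ((genericPoint_spec X).specializes trivial)).eq

theorem eq_genericPoint_of_specializes {X : Type*} [TopologicalSpace X] [T0Space X]
    [QuasiSober X] [IrreducibleSpace X] {x : X} (h : x ⤳ genericPoint X) : x = genericPoint X :=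
  (h.antisymm ((genericPoint_spec X).specializes trivial)).eq

/-! ### Covers from field extensions, and almost covered sets -/

namespace HilbertProp

variable {K : Type u} [Field K]

theorem IsVariety.isSeparated_left {X : Over (Spec (.of K))} (hX : IsVariety X) :
    X.left.IsSeparated := by
  have := hX.isSeparated
  constructor
  rw [← Limits.terminal.comp_from X.hom]
  infer_instance

theorem IsVariety.isNoetherian {X : Over (Spec (.of K))} (hX : IsVariety X) :
    IsNoetherian X.left := by
  have := hX.locallyOfFiniteType
  have := hX.quasiCompact
  have : IsLocallyNoetherian X.left := LocallyOfFiniteType.isLocallyNoetherian X.hom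
  have : CompactSpace X.left := by
    exact (quasiCompact_iff_compactSpace X.hom).mp hX.quasiCompact
  exact {}

theorem IsVariety.locallyOfFiniteType_left {X Y : Over (Spec (.of K))} (hX : IsVariety X)
    (hY : IsVariety Y) (f : Y ⟶ X) : LocallyOfFiniteType f.left := by
  have := hX.isSeparated
  have := hY.locallyOfFiniteType
  have : LocallyOfFiniteType (f.left ≫ X.hom) := by rwa [Over.w f]
  exact locallyOfFiniteType_of_comp f.left X.hom

/-- The normalization of `X` in a finite, geometrically integral extension `L` of its function
field, as a cover of `X`. -/
noncomputable def coverOfExtension (X : Over (Spec (.of K))) [IsIntegral X.left] (hX : IsVariety X)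
    [X.left.IsSeparated] (L : Type u) [Field L] [Algebra X.left.functionField L]
    [FiniteDimensional X.left.functionField L]
    (hL : GeometricallyIntegral (fromSpecExtension X.left L ≫ X.hom)) : Cover X :=
  have := hX.locallyOfFiniteType
  have := hX.isSeparated
  have := hX.quasiCompact
  have hfin := isFinite_fromNormalizationIn X.left L X.hom
  have hsurj := surjective_fromNormalizationIn X.left L
  { Y := Over.mk (fromNormalizationIn X.left L ≫ X.hom)
    φ := Over.homMk (fromNormalizationIn X.left L)
    isVariety :=
      { isSeparated := by dsimp; infer_instance
        locallyOfFiniteType := by dsimp; infer_instance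
        quasiCompact := by dsimp; infer_instance
        isReduced := by dsimp; infer_instance
        dim_pos := by
          obtain ⟨x, hx⟩ := exists_ne_genericPoint_of_topologicalKrullDim_pos hX.dim_pos
          obtain ⟨z, rfl⟩ := hsurj.surj x
          refine topologicalKrullDim_pos_of_ne_genericPoint (X := normalizationIn X.left L)
            (x := z) fun h => hx ?_
          rw [h, map_genericPoint] }
    isIntegral := by dsimp; infer_instance
    isNormal := isNormal_normalizationIn X.left L
    geometricallyIntegral := geometricallyIntegral_normalizationIn X.left L X.hom
    isFinite := hfin
    surjective := hsurj }

theorem degree_coverOfExtension (X : Over (Spec (.of K))) [IsIntegral X.left] (hX : IsVariety X)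
    [X.left.IsSeparated] (L : Type u) [Field L] [Algebra X.left.functionField L]
    [FiniteDimensional X.left.functionField L]
    (hL : GeometricallyIntegral (fromSpecExtension X.left L ≫ X.hom)) :
    (coverOfExtension X hX L hL).degree = Module.finrank X.left.functionField L :=
  have := surjective_fromNormalizationIn X.left L
  degree_fromNormalizationIn X.left L

theorem isZariskiDense_iff_genericPoint_mem {X : Over (Spec (.of K))} [IsIntegral X.left]
    {M : Set (RationalPoints X)} : IsZariskiDense M ↔
      genericPoint X.left ∈ closure (⋃ x ∈ M, Set.range x.left : Set X.left) := by
  rw [IsZariskiDense, dense_iff_closure_eq]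
  refine ⟨fun h => h ▸ trivial, fun h => Set.eq_univ_of_univ_subset ?_⟩
  rw [← (genericPoint_spec X.left).def]
  exact closure_minimal (Set.singleton_subset_iff.mpr h) isClosed_closure

theorem IsZariskiDense.mono {X : Over (Spec (.of K))} {M N : Set (RationalPoints X)}
    (hM : IsZariskiDense M) (h : M ⊆ N) : IsZariskiDense N :=
  Dense.mono (Set.biUnion_subset_biUnion_left h) hM

theorem isZariskiDense_union_iff {X : Over (Spec (.of K))} [IsIntegral X.left]
    {M N : Set (RationalPoints X)} :
    IsZariskiDense (M ∪ N) ↔ IsZariskiDense M ∨ IsZariskiDense N := by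
  rw [isZariskiDense_iff_genericPoint_mem, isZariskiDense_iff_genericPoint_mem,
    isZariskiDense_iff_genericPoint_mem, ← Set.mem_union, ← closure_union, ← Set.biUnion_union]

/-- `M` is contained, up to a set that is not Zariski dense, in a finite union of images of covers
of degree `> 1`. -/
def IsAlmostCovered (X : Over (Spec (.of K))) [IsIntegral X.left] (M : Set (RationalPoints X)) :
    Prop :=
  ∃ (r : ℕ) (c : Fin r → Cover X), (∀ i, 1 < (c i).degree) ∧
    ¬ IsZariskiDense (M \ ⋃ i, imagePoints (c i).φ)

variable {X : Over (Spec (.of K))} [IsIntegral X.left]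

theorem IsAlmostCovered.mono {M N : Set (RationalPoints X)} (hN : IsAlmostCovered X N)
    (h : M ⊆ N) : IsAlmostCovered X M := by
  obtain ⟨r, c, hc, hd⟩ := hN
  exact ⟨r, c, hc, fun h' => hd (h'.mono (Set.sdiff_subset_sdiff_left h))⟩

theorem isAlmostCovered_of_not_isZariskiDense {M : Set (RationalPoints X)}
    (hM : ¬ IsZariskiDense M) : IsAlmostCovered X M :=
  ⟨0, Fin.elim0, fun i => i.elim0, by simpa using hM⟩

theorem IsAlmostCovered.union {M N : Set (RationalPoints X)} (hM : IsAlmostCovered X M)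
    (hN : IsAlmostCovered X N) : IsAlmostCovered X (M ∪ N) := by
  obtain ⟨r, c, hc, hd⟩ := hM
  obtain ⟨r', c', hc', hd'⟩ := hN
  refine ⟨r + r', Fin.append c c', fun i => ?_, fun h => ?_⟩
  · refine Fin.addCases (fun i => ?_) (fun i => ?_) i
    · simpa using hc i
    · simpa using hc' i
  · have : (M ∪ N) \ ⋃ i, imagePoints (Fin.append c c' i).φ ⊆
        (M \ ⋃ i, imagePoints (c i).φ) ∪ (N \ ⋃ i, imagePoints (c' i).φ) := by
      rintro x ⟨hx, hx'⟩
      simp only [Set.mem_iUnion, not_exists] at hx'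
      refine hx.imp (fun h => ⟨h, ?_⟩) fun h => ⟨h, ?_⟩
      · simp only [Set.mem_iUnion, not_exists]
        intro i
        have := hx' (Fin.castAdd r' i)
        rwa [Fin.append_left] at this
      · simp only [Set.mem_iUnion, not_exists]
        intro i
        have := hx' (Fin.natAdd r i)
        rwa [Fin.append_right] at this
    exact (isZariskiDense_union_iff.mp (h.mono this)).elim hd hd'

theorem isAlmostCovered_biUnion {ι : Type*} {S : Set ι} (hS : S.Finite)
    {M : ι → Set (RationalPoints X)} (h : ∀ i ∈ S, IsAlmostCovered X (M i)) :
    IsAlmostCovered X (⋃ i ∈ S, M i) := by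
  induction S, hS using Set.Finite.induction_on with
  | empty =>
    refine isAlmostCovered_of_not_isZariskiDense ?_
    simp [isZariskiDense_iff_genericPoint_mem]
  | insert _ _ ih =>
    rw [Set.biUnion_insert]
    exact (h _ (Set.mem_insert _ _)).union (ih fun i hi => h i (Set.mem_insert_of_mem _ hi))

end HilbertProp

/-! ### Thin sets are almost covered -/

namespace HilbertProp

variable {K : Type u} [Field K] {X Y : Over (Spec (.of K))} [IsIntegral X.left]

theorem not_isZariskiDense_of_forall_ne [IsNoetherian Y.left] (f : Y ⟶ X) {C : Set Y.left}
    (hC : IsClosed C) (h : ∀ c ∈ C, f.left c ≠ genericPoint X.left)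
    {M : Set (RationalPoints X)}
    (hM : ∀ x ∈ M, ∃ y : RationalPoints Y, Set.range y.left ⊆ C ∧ y ≫ f = x) :
    ¬ IsZariskiDense M := by
  rw [isZariskiDense_iff_genericPoint_mem]
  refine fun hd => notMem_closure_image_of_forall_ne f.left.continuous hC
    (fun x => eq_genericPoint_of_specializes) h (closure_mono ?_ hd)
  refine Set.iUnion₂_subset fun x hx => ?_
  obtain ⟨y, hy, rfl⟩ := hM x hx
  rintro _ ⟨t, rfl⟩
  exact ⟨y.left t, hy ⟨t, rfl⟩, by simp⟩

/-- The images of the rational points of one irreducible component `closure {y}` of `Y` are almost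
covered, by at most one cover: the normalization of `X` in the local ring of `Y` at `y`. -/
theorem isAlmostCovered_of_isGeneric (hX : IsVariety X) (hY : IsVariety Y) (f : Y ⟶ X)
    (hfin : (f.left ⁻¹' {genericPoint X.left}).Finite) (hsec : ¬ HasRationalSection f)
    {y : Y.left} (hy : closure {y} ∈ irreducibleComponents Y.left) {M : Set (RationalPoints X)}
    (hM : ∀ x ∈ M, ∃ t : RationalPoints Y, Set.range t.left ⊆ closure {y} ∧ t ≫ f = x) :
    IsAlmostCovered X M := by
  have := hX.isSeparated_left
  have := hY.isReduced
  have := hY.isNoetherian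
  have := hX.locallyOfFiniteType_left hY f
  by_cases hfy : f.left y = genericPoint X.left
  swap
  · refine isAlmostCovered_of_not_isZariskiDense
      (not_isZariskiDense_of_forall_ne f isClosed_closure (fun c hc h => hfy ?_) hM)
    refine eq_genericPoint_of_specializes (h ▸ ?_)
    exact (specializes_iff_mem_closure.mpr hc).map f.left.continuous
  -- Over the generic point the only point of the component is `y`.
  have hne : ∀ V : Y.left.Opens, y ∈ V → ∀ c ∈ closure {y} \ (V : Set Y.left),
      f.left c ≠ genericPoint X.left := fun V hV c hc h =>
    hc.2 ((isDiscrete_preimage_singleton_of_finite f.left hfin).eq_of_specializes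
      (specializes_iff_mem_closure.mpr hc.1) hfy h ▸ hV)
  obtain ⟨L, _, _, e, _, he⟩ := exists_finite_extension_of_isGeneric f.left hfin hy hfy
  have hL : 1 < Module.finrank X.left.functionField L := by
    refine lt_of_le_of_ne Module.finrank_pos fun h => hsec ?_
    exact exists_section_of_finrank_eq_one f.left (e.hom ≫ Y.left.fromSpecStalk y)
      (by rw [Category.assoc, he]) h.symm
  by_cases hV : ∀ V : Y.left.Opens, y ∈ V →
      ∃ s : RationalPoints Y, Set.range s.left ⊆ (V : Set Y.left)
  · have hgi := geometricallyIntegral_of_forall_exists_point e hV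
    rw [← Over.w f, reassoc_of% he] at hgi
    let c := coverOfExtension X hX L hgi
    have : LocallyOfFiniteType c.φ.left := by
      have := c.isFinite
      infer_instance
    obtain ⟨V, hyV, ψ, hψ⟩ := exists_spread_out f.left c.φ.left e
      (fromSpecExtension X.left L).toNormalization (by
        rw [he]
        exact (fromSpecExtension X.left L).toNormalization_fromNormalization)
    refine ⟨1, fun _ => c, fun _ => by rwa [degree_coverOfExtension], ?_⟩
    refine not_isZariskiDense_of_forall_ne f (isClosed_closure.sdiff V.isOpen) (hne V hyV)
      fun x hx => ?_
    obtain ⟨t, ht, rfl⟩ := hM x hx.1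
    refine ⟨t, ?_, rfl⟩
    rintro _ ⟨p, rfl⟩
    refine ⟨ht ⟨p, rfl⟩, fun hp => hx.2 (Set.mem_iUnion.mpr ⟨0, ?_⟩)⟩
    -- `Spec K` is a single point, so the rational point `t` lies in `V`.
    have hr : Set.range t.left ⊆ Set.range V.ι := by
      rw [Scheme.Opens.range_ι]
      rintro _ ⟨q, rfl⟩
      obtain rfl : q = p := Subsingleton.elim (α := PrimeSpectrum K) q p
      exact hp
    have hl := IsOpenImmersion.lift_fac V.ι t.left hr
    have hw : (IsOpenImmersion.lift V.ι t.left hr ≫ ψ) ≫ c.φ.left = (t ≫ f).left := by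
      rw [Category.assoc, hψ, reassoc_of% hl, Over.comp_left]
    refine ⟨Over.homMk (IsOpenImmersion.lift V.ι t.left hr ≫ ψ) ?_, ?_⟩
    · rw [← Over.w c.φ, ← Category.assoc, hw, Over.w]
    · ext1
      exact hw
  · -- Some neighbourhood `V` of `y` has no rational points.
    push Not at hV
    obtain ⟨V, hyV, hV⟩ := hV
    refine isAlmostCovered_of_not_isZariskiDense (not_isZariskiDense_of_forall_ne f
      (isClosed_closure.sdiff V.isOpen) (hne V hyV) fun x hx => ?_)
    obtain ⟨t, ht, rfl⟩ := hM x hx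
    refine ⟨t, ?_, rfl⟩
    rintro _ ⟨p, rfl⟩
    refine ⟨ht ⟨p, rfl⟩, fun hp => hV t ?_⟩
    rintro _ ⟨q, rfl⟩
    obtain rfl : q = p := Subsingleton.elim (α := PrimeSpectrum K) q p
    exact hp

theorem IsThin.isAlmostCovered (hX : IsVariety X) {M : Set (RationalPoints X)} (hM : IsThin X M) :
    IsAlmostCovered X M := by
  obtain ⟨Y, f, hY, hMf, hfin, hsec⟩ := hM
  have := hY.isNoetherian
  refine (isAlmostCovered_biUnion
    (TopologicalSpace.NoetherianSpace.finite_irreducibleComponents (α := Y.left))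
    (M := fun Z => {x | ∃ t : RationalPoints Y, Set.range t.left ⊆ Z ∧ t ≫ f = x})
    fun Z hZ => ?_).mono ?_
  · obtain ⟨y, rfl⟩ := QuasiSober.sober hZ.1 (isClosed_of_mem_irreducibleComponents Z hZ)
    exact isAlmostCovered_of_isGeneric hX hY f hfin hsec hZ fun x hx => hx
  · rintro x hx
    obtain ⟨t, rfl⟩ := hMf hx
    obtain ⟨p⟩ : Nonempty (Spec (.of K)) := inferInstance
    refine Set.mem_biUnion (irreducibleComponent_mem_irreducibleComponents (t.left p)) ⟨t, ?_, rfl⟩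
    rintro _ ⟨q, rfl⟩
    obtain rfl : q = p := Subsingleton.elim (α := PrimeSpectrum K) q p
    exact mem_irreducibleComponent

end HilbertProp

/-! ### Disjoint unions, closed subschemes and affine spaces -/

namespace AlgebraicGeometry

open Limits

theorem isSeparated_coprodDesc {X Y S : Scheme.{u}} {f : X ⟶ S} {g : Y ⟶ S} (hf : IsSeparated f)
    (hg : IsSeparated g) : IsSeparated (coprod.desc f g) := by
  have := IsZariskiLocalAtTarget.coprodMap (P := @IsSeparated) f g hf hg
  rw [show coprod.desc f g = coprod.map f g ≫ coprod.desc (𝟙 S) (𝟙 S) by simp]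
  infer_instance

theorem locallyOfFiniteType_coprodDesc {X Y S : Scheme.{u}} {f : X ⟶ S} {g : Y ⟶ S}
    (hf : LocallyOfFiniteType f) (hg : LocallyOfFiniteType g) :
    LocallyOfFiniteType (coprod.desc f g) := by
  let := HasRingHomProperty.instIsZariskiLocalAtTarget (P := @LocallyOfFiniteType.{u})
    (Q := RingHom.FiniteType)
  have := @IsZariskiLocalAtTarget.coprodMap @LocallyOfFiniteType this _ _ _ _ f g hf hg
  rw [show coprod.desc f g = coprod.map f g ≫ coprod.desc (𝟙 S) (𝟙 S) by simp]
  infer_instance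

instance isReduced_coprod {X Y : Scheme.{u}} [IsReduced X] [IsReduced Y] :
    IsReduced (X ⨿ Y : Scheme.{u}) := by
  have : ∀ i, IsReduced ((coprodOpenCover.{u, 0} X Y).X i) := by
    rintro (_ | _)
    · exact ‹IsReduced X›
    · exact ‹IsReduced Y›
  exact .of_openCover _ (coprodOpenCover.{u, 0} X Y)

theorem mem_range_coprod {X Y : Scheme.{u}} (z : (X ⨿ Y : Scheme.{u})) :
    z ∈ Set.range (coprod.inl : X ⟶ X ⨿ Y) ∨ z ∈ Set.range (coprod.inr : Y ⟶ X ⨿ Y) :=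
  (isCompl_range_inl_inr X Y).sup_eq_top.ge (Set.mem_univ z)

instance isReduced_subscheme_vanishingIdeal {X : Scheme.{u}} (Z : TopologicalSpace.Closeds X) :
    IsReduced (Scheme.IdealSheafData.vanishingIdeal Z).subscheme := by
  have : ∀ i, IsReduced
      ((Scheme.IdealSheafData.vanishingIdeal Z).subschemeCover.openCover.X i) := by
    intro (U : X.affineOpens)
    change IsReduced (Spec (.of (_ ⧸ (Scheme.IdealSheafData.vanishingIdeal Z).ideal U)))
    rw [affine_isReduced_iff]
    refine (Ideal.isRadical_iff_quotient_reduced _).mp ?_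
    rw [Scheme.IdealSheafData.vanishingIdeal_ideal]
    exact PrimeSpectrum.isRadical_vanishingIdeal _
  exact .of_openCover _ (Scheme.IdealSheafData.vanishingIdeal Z).subschemeCover.openCover

theorem vanishingIdeal_le_ker {X Y : Scheme.{u}} [IsReduced Y] (f : Y ⟶ X) [QuasiCompact f]
    {Z : TopologicalSpace.Closeds X} (h : Set.range f ⊆ Z) :
    Scheme.IdealSheafData.vanishingIdeal Z ≤ f.ker := by
  rw [← Scheme.IdealSheafData.map_bot, ← Scheme.nilradical_eq_bot,
    ← Scheme.IdealSheafData.vanishingIdeal_top, Scheme.IdealSheafData.map_vanishingIdeal]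
  refine Scheme.IdealSheafData.vanishingIdeal_antimono ?_
  rw [TopologicalSpace.Closeds.closure_le]
  simpa using h

/-- An affine space with at least one coordinate over a nonempty scheme of finite type over a field
has positive dimension: otherwise it would be finite over the field, hence over the base. -/
theorem topologicalKrullDim_affineSpace_pos {k : Type u} [Field k] (n : Type u) [Finite n]
    [Nonempty n] {S : Scheme.{u}} [Nonempty S] (p : S ⟶ Spec (.of k)) [LocallyOfFiniteType p]
    [QuasiCompact p] [IsSeparated p] : 0 < topologicalKrullDim 𝔸(n; S) := by
  by_contra! h
  have : IsLocallyNoetherian 𝔸(n; S) :=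
    LocallyOfFiniteType.isLocallyNoetherian ((𝔸(n; S) ↘ S) ≫ p)
  have := IsLocallyArtinian.of_topologicalKrullDim_le_zero h
  have : LocallyQuasiFinite ((𝔸(n; S) ↘ S) ≫ p) :=
    locallyQuasiFinite_iff_isDiscrete_preimage_singleton.mpr fun _ => DiscreteTopology.isDiscrete
  have : IsLocallyArtinian (Spec (.of k)) := by
    rw [Scheme.isLocallyArtinianScheme_Spec]
    infer_instance
  have : IsFinite ((𝔸(n; S) ↘ S) ≫ p) := .of_locallyQuasiFinite _
  have : IsFinite (𝔸(n; S) ↘ S) := .of_comp _ p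
  exact AffineSpace.not_isIntegralHom (n := n) (S := S) inferInstance

/-- A finite morphism of integral schemes with a section over the generic point has degree `1`: the
section hits the generic point, the only point of `Y` over the generic point of `X`, and provides a
homomorphism from the function field of `Y` back to that of `X`. -/
theorem degree_eq_one_of_section {X Y : Scheme.{u}} [IsIntegral X] [IsIntegral Y]
    (f : Y ⟶ X) [IsFinite f] [IsDominant f]
    (s : Spec (X.presheaf.stalk (genericPoint X)) ⟶ Y)
    (hs : s ≫ f = X.fromSpecStalk (genericPoint X)) : HilbertProp.degree f = 1 := by
  let p : Spec (X.presheaf.stalk (genericPoint X)) := IsLocalRing.closedPoint _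
  have hp : f (s p) = genericPoint X := by
    rw [← Scheme.Hom.comp_apply, hs]
    exact Scheme.fromSpecStalk_closedPoint
  have hsp : genericPoint Y = s p :=
    (f.isDiscrete_preimage_singleton (genericPoint X)).eq_of_specializes
      (genericPoint_specializes _) (HilbertProp.map_genericPoint f) hp
  let τ : Y.functionField ⟶ X.functionField :=
    Y.presheaf.stalkSpecializes (specializes_of_eq hsp.symm) ≫ Scheme.stalkClosedPointTo s
  have hτ : HilbertProp.functionFieldMap f ≫ τ = 𝟙 _ := by
    apply Spec.map_injective
    rw [← cancel_mono (X.fromSpecStalk (genericPoint X))]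
    simp only [τ, HilbertProp.functionFieldMap, Spec.map_comp, Category.assoc,
      Scheme.SpecMap_stalkSpecializes_fromSpecStalk, Scheme.SpecMap_stalkMap_fromSpecStalk,
      Spec.map_id, Category.id_comp]
    rw [Scheme.SpecMap_stalkSpecializes_fromSpecStalk_assoc,
      Scheme.Spec_stalkClosedPointTo_fromSpecStalk_assoc, hs]
  let := (HilbertProp.functionFieldMap f).hom.toAlgebra
  change Module.finrank X.functionField Y.functionField = 1
  have hinv : Function.LeftInverse τ (algebraMap X.functionField Y.functionField) :=
    fun a => congr($hτ a)
  have hb : Function.Bijective (algebraMap X.functionField Y.functionField) :=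
    ⟨hinv.injective, (hinv.rightInverse_of_injective (RingHom.injective τ.hom)).surjective⟩
  exact (LinearEquiv.ofBijective (Algebra.linearMap X.functionField Y.functionField)
    hb).finrank_eq.symm.trans (Module.finrank_self _)

end AlgebraicGeometry

/-! ### Almost covered sets are thin -/

namespace HilbertProp

variable {K : Type u} [Field K] {X : Over (Spec (.of K))} [IsIntegral X.left]

theorem IsThin.mono {M N : Set (RationalPoints X)} (hN : IsThin X N) (h : M ⊆ N) : IsThin X M := by
  obtain ⟨Y, f, hY, hN, hfin, hsec⟩ := hN
  exact ⟨Y, f, hY, h.trans hN, hfin, hsec⟩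

open Limits in
theorem IsVariety.coprod {Y Z : Over (Spec (.of K))} (hY : IsVariety Y) (hZ : IsVariety Z) :
    IsVariety (Over.mk (coprod.desc Y.hom Z.hom)) where
  isSeparated := isSeparated_coprodDesc hY.isSeparated hZ.isSeparated
  locallyOfFiniteType :=
    locallyOfFiniteType_coprodDesc hY.locallyOfFiniteType hZ.locallyOfFiniteType
  quasiCompact := by
    have := hY.isNoetherian
    have := hZ.isNoetherian
    exact (quasiCompact_iff_compactSpace _).mpr (coprodMk Y.left Z.left).compactSpace
  isReduced :=
    have := hY.isReduced
    have := hZ.isReduced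
    isReduced_coprod
  dim_pos := hY.dim_pos.trans_le
    (coprod.inl : Y.left ⟶ Y.left ⨿ Z.left).isOpenEmbedding.isInducing.topologicalKrullDim_le

open Limits in
/-- If `Y` and `Z` witness that `M` and `N` are thin, their disjoint union witnesses it for the
union. -/
theorem IsThin.union (hX : IsVariety X) {M N : Set (RationalPoints X)} (hM : IsThin X M)
    (hN : IsThin X N) : IsThin X (M ∪ N) := by
  obtain ⟨Y, f, hY, hM, hfin, hsec⟩ := hM
  obtain ⟨Z, g, hZ, hN, hgin, hsec'⟩ := hN
  have hYZ := hY.coprod hZ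
  let h : Over.mk (coprod.desc Y.hom Z.hom) ⟶ X := Over.homMk (coprod.desc f.left g.left) (by
    apply coprod.hom_ext <;> simp)
  have hl : coprod.inl ≫ h.left = f.left := coprod.inl_desc _ _
  have hr : coprod.inr ≫ h.left = g.left := coprod.inr_desc _ _
  have := hX.locallyOfFiniteType_left hY f
  have := hX.locallyOfFiniteType_left hZ g
  have := hX.locallyOfFiniteType_left hYZ h
  refine ⟨_, h, hYZ, ?_, ?_, ?_⟩
  · rintro x (hx | hx)
    · obtain ⟨t, rfl⟩ := hM hx
      refine ⟨t ≫ Over.homMk coprod.inl (coprod.inl_desc _ _), ?_⟩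
      ext1
      simp [hl]
    · obtain ⟨t, rfl⟩ := hN hx
      refine ⟨t ≫ Over.homMk coprod.inr (coprod.inr_desc _ _), ?_⟩
      ext1
      simp [hr]
  · refine ((hfin.image (coprod.inl : Y.left ⟶ Y.left ⨿ Z.left)).union
      (hgin.image (coprod.inr : Z.left ⟶ Y.left ⨿ Z.left))).subset fun z hz => ?_
    obtain ⟨y, rfl⟩ | ⟨y, rfl⟩ := mem_range_coprod z
    · refine .inl ⟨y, ?_, rfl⟩
      rwa [← hl, Scheme.Hom.comp_base, TopCat.coe_comp, Set.preimage_comp]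
    · refine .inr ⟨y, ?_, rfl⟩
      rwa [← hr, Scheme.Hom.comp_base, TopCat.coe_comp, Set.preimage_comp]
  · rw [HasRationalSection, exists_partialMap_section_iff] at hsec hsec' ⊢
    rintro ⟨s, hs⟩
    -- The spectrum of the function field is a single point, so `s` factors through `Y` or `Z`.
    let p : Spec (X.left.presheaf.stalk (genericPoint X.left)) := IsLocalRing.closedPoint _
    have hp : ∀ q : Spec (X.left.presheaf.stalk (genericPoint X.left)), q = p := fun q =>
      Subsingleton.elim (α := PrimeSpectrum X.left.functionField) q p
    obtain hz | hz := mem_range_coprod (s p)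
    · have hsub : Set.range s ⊆ Set.range (coprod.inl : Y.left ⟶ Y.left ⨿ Z.left) := by
        rintro _ ⟨q, rfl⟩
        rwa [hp q]
      exact hsec ⟨IsOpenImmersion.lift coprod.inl s hsub, by
        rw [← hl, IsOpenImmersion.lift_fac_assoc, hs]⟩
    · have hsub : Set.range s ⊆ Set.range (coprod.inr : Z.left ⟶ Y.left ⨿ Z.left) := by
        rintro _ ⟨q, rfl⟩
        rwa [hp q]
      exact hsec' ⟨IsOpenImmersion.lift coprod.inr s hsub, by
        rw [← hr, IsOpenImmersion.lift_fac_assoc, hs]⟩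

theorem isThin_imagePoints (c : Cover X) (hX : IsVariety X) (hc : 1 < c.degree) :
    IsThin X (imagePoints c.φ) := by
  have := c.isIntegral
  have := c.isFinite
  have := c.surjective
  have := hX.locallyOfFiniteType_left c.isVariety c.φ
  refine ⟨c.Y, c.φ, c.isVariety, le_rfl, c.φ.left.finite_preimage_singleton _, ?_⟩
  rw [HasRationalSection, exists_partialMap_section_iff]
  rintro ⟨s, hs⟩
  exact hc.ne' (degree_eq_one_of_section c.φ.left s hs)

/-- A set of rational points on a proper closed subscheme `W` is thin: the points lift along
`𝔸¹ × W ⟶ X`, whose generic fibre is empty. The product with `𝔸¹` is needed because `W` may have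
dimension `0`. -/
theorem isThin_of_isClosedImmersion (hX : IsVariety X) {W : Scheme.{u}} [IsReduced W] [Nonempty W]
    (i : W ⟶ X.left) [IsClosedImmersion i] (hi : genericPoint X.left ∉ Set.range i)
    {M : Set (RationalPoints X)} (hM : ∀ x ∈ M, ∃ t : Spec (.of K) ⟶ W, t ≫ i = x.left) :
    IsThin X M := by
  have := hX.locallyOfFiniteType
  have := hX.isSeparated
  have := hX.quasiCompact
  have hπ (w : 𝔸(PUnit.{u + 1}; W)) : ((𝔸(PUnit.{u + 1}; W) ↘ W) ≫ i) w ≠ genericPoint X.left :=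
    fun h => hi ⟨(𝔸(PUnit.{u + 1}; W) ↘ W) w, by rw [← h, Scheme.Hom.comp_apply]⟩
  refine ⟨Over.mk (((𝔸(PUnit.{u + 1}; W) ↘ W) ≫ i) ≫ X.hom),
    Over.homMk ((𝔸(PUnit.{u + 1}; W) ↘ W) ≫ i), ⟨?_, ?_, ?_, ?_, ?_⟩, fun x hx => ?_, ?_, ?_⟩
  · dsimp; infer_instance
  · dsimp; infer_instance
  · dsimp; infer_instance
  · dsimp; infer_instance
  · exact topologicalKrullDim_affineSpace_pos PUnit.{u + 1} (i ≫ X.hom)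
  · obtain ⟨t, ht⟩ := hM x hx
    have hfac : AffineSpace.homOfVector (n := PUnit.{u + 1}) t 0 ≫
        (𝔸(PUnit.{u + 1}; W) ↘ W) ≫ i = x.left := by
      rw [AffineSpace.homOfVector_over_assoc, ht]
    refine ⟨Over.homMk (AffineSpace.homOfVector t 0) ?_, ?_⟩
    · exact (Category.assoc _ _ _).symm.trans ((congrArg (· ≫ X.hom) hfac).trans (Over.w x))
    · ext1
      exact hfac
  · exact Set.finite_empty.subset fun w hw => hπ w hw
  · rintro ⟨ψ, hψ⟩
    have h := (genericPoint_specializes (α := X.left) _).mem_open ψ.domain.isOpen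
      ψ.dense_domain.nonempty.some_mem
    exact hπ (ψ.hom ⟨genericPoint X.left, h⟩) congr($hψ ⟨genericPoint X.left, h⟩)

theorem isThin_of_not_isZariskiDense (hX : IsVariety X) {M : Set (RationalPoints X)}
    (hM : ¬ IsZariskiDense M) : IsThin X M := by
  rw [isZariskiDense_iff_genericPoint_mem] at hM
  obtain ⟨x₀, hx₀⟩ := exists_ne_genericPoint_of_topologicalKrullDim_pos hX.dim_pos
  -- The point `x₀` is added to make the closed set nonempty even if `M` is empty.
  let C : TopologicalSpace.Closeds X.left :=
    ⟨closure (⋃ x ∈ M, Set.range x.left) ∪ closure {x₀}, isClosed_closure.union isClosed_closure⟩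
  have hC : genericPoint X.left ∉ C := by
    rintro (h | h)
    · exact hM h
    · exact hx₀ (eq_genericPoint_of_specializes (specializes_iff_mem_closure.mpr h))
  let I := Scheme.IdealSheafData.vanishingIdeal C
  have hI : Set.range I.subschemeι = C := by
    rw [I.range_subschemeι, Scheme.IdealSheafData.coe_support_vanishingIdeal]
  obtain ⟨w, -⟩ := hI.ge (.inr (subset_closure rfl) : x₀ ∈ C)
  have : Nonempty I.subscheme := ⟨w⟩
  refine isThin_of_isClosedImmersion hX I.subschemeι (hI ▸ hC) fun x hx => ?_
  have hle : I.subschemeι.ker ≤ x.left.ker := by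
    rw [I.ker_subschemeι]
    refine vanishingIdeal_le_ker (Y := Spec (.of K)) _ ?_
    exact (Set.subset_biUnion_of_mem (u := fun x : RationalPoints X => Set.range x.left) hx).trans
      (subset_closure.trans Set.subset_union_left)
  exact ⟨IsClosedImmersion.lift I.subschemeι x.left hle, IsClosedImmersion.lift_fac _ _ _⟩

theorem IsAlmostCovered.isThin (hX : IsVariety X) {M : Set (RationalPoints X)}
    (hM : IsAlmostCovered X M) : IsThin X M := by
  obtain ⟨r, c, hc, hd⟩ := hM
  have h : ∀ T : Finset (Fin r), IsThin X
      ((M \ ⋃ i, imagePoints (c i).φ) ∪ ⋃ i ∈ T, imagePoints (c i).φ) := by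
    intro T
    induction T using Finset.induction_on with
    | empty => simpa using isThin_of_not_isZariskiDense hX hd
    | insert i T _ ih =>
      refine (ih.union hX (isThin_imagePoints (c i) hX (hc i))).mono ?_
      rw [Finset.set_biUnion_insert, Set.union_comm (imagePoints _), Set.union_assoc]
  refine (h Finset.univ).mono ?_
  simp

theorem isThin_iff_isAlmostCovered (hX : IsVariety X) {M : Set (RationalPoints X)} :
    IsThin X M ↔ IsAlmostCovered X M :=
  ⟨fun h => h.isAlmostCovered hX, fun h => h.isThin hX⟩

end HilbertProp

theorem proposition2p1 {K : Type u} [Field K] (X : Over (Spec (.of K))) [IsIntegral X.left]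
    (hX : HilbertProp.IsVariety X) (hq : HilbertProp.IsQuasiProjective X) :
    (∀ M : Set (HilbertProp.RationalPoints X),
      HilbertProp.IsThin X M ↔
        ∃ (r : ℕ) (c : Fin r → HilbertProp.Cover X), (∀ i, 1 < (c i).degree) ∧
          ¬ HilbertProp.IsZariskiDense (M \ ⋃ i, HilbertProp.imagePoints (c i).φ)) ∧
    (HilbertProp.HasHilbertProperty X ↔
      ∀ (r : ℕ) (c : Fin r → HilbertProp.Cover X), (∀ i, 1 < (c i).degree) →
        HilbertProp.IsZariskiDense
          (Set.univ \ ⋃ i, HilbertProp.imagePoints (c i).φ)) := by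
  refine ⟨fun M => HilbertProp.isThin_iff_isAlmostCovered hX, ?_⟩
  rw [HilbertProp.HasHilbertProperty, HilbertProp.isThin_iff_isAlmostCovered hX,
    HilbertProp.IsAlmostCovered]
  push Not
  rfl
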